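/- **Lemma 2.** Let $h\ge 0$, $\lambda_{\rm UAV}>0$, $C>0$, $Y\in\mathbb{R}$, and $C_i>0$, $a_i>0$ for $i\in\{L,N\}$; write $i^*$ for the element of $\{L,N\}$ other than $i$. Let UAVs be placed in the plane at altitude $h$ above the ground at the points of a homogeneous Poisson point process on $\mathbb{R}^2$ of intensity $\lambda_{\rm UAV}$. The user equipment (UE) is on the ground below the origin, so that a UAV at horizontal distance $\rho$ has distance $r=\sqrt{\rho^2+h^2}$ from the UE. Given the positions, the UAVs are independently of one another in state $L$ (line of sight) with probability $p_L(\rho)$ or in state $N$ (non-line of sight) with probability $p_N(\rho)=1-p_L(\rho)$, where $\rho$ is the horizontal distance of the UAV and $$p_L(\rho)=\frac{1}{1+C\exp\left[-Y\left(\arcsin\left(\frac{h}{\sqrt{\rho^2+h^2}}\right)\frac{180}{\pi}-C\right)\right]}.$$ A UAV in state $i$ at distance $r$ from the UE has path gain $\ell_i(r)=C_i r^{-a_i}$, and the UE connects to a UAV of maximum path gain. For $s\ge 0$ put $b(s)=\sqrt{s^2-h^2}$ if $s\ge h$ and $b(s)=0$ if $s<h$. For $i\in\{L,N\}$ and $r>h$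 let $$A_i(r)=\left(\frac{C_{i^*}}{C_i}r^{a_i}\right)^{1/a_{i^*}},\qquad f_i(r)=2\pi\lambda_{\rm UAV}\,r\,p_i(b(r))\exp\left(-2\pi\lambda_{\rm UAV}\int_0^{b(r)}p_i(\rho)\rho\,d\rho\right).$$ Then, for each $i\in\{L,N\}$, the probability $P_i$ that the UE connects to a UAV in state $i$ is $$P_i=\int_h^\infty \exp\left(-2\pi\lambda_{\rm UAV}\int_0^{b(A_i(r))}p_{i^*}(\rho)\rho\,d\rho\right)f_i(r)\,dr,$$ where the integral converges. -/

import Mathlib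

open MeasureTheory ProbabilityTheory Set

noncomputable section

namespace UAV

/-- The plane in which the UAVs are deployed; the user equipment (UE) projects to its origin. -/
abbrev Plane : Type := EuclideanSpace ℝ (Fin 2)

/-- Propagation state of a link: line of sight or non-line of sight. -/
inductive LinkState : Type
  | los
  | nlos

instance : MeasurableSpace LinkState := ⊤

/-- The opposite link state `i*`. -/
def LinkState.opp : LinkState → LinkState
  | .los => .nlos
  | .nlos => .los

/-- Number of points of the configuration `n ↦ X n ω` that lie in `B` (with multiplicity). -/
def count {Ω : Type*} (X : ℕ → Ω → Plane) (B : Set Plane) (ω : Ω) : ℕ∞ :=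
  {n : ℕ | X n ω ∈ B}.encard

/-- The random points `X 0, X 1, …` enumerate a homogeneous Poisson point process of intensity
`lam` on the whole plane: counts in Borel sets of finite area are Poisson distributed, with mean
`lam` times the area, and counts in disjoint such sets are independent. -/
structure IsHomogeneousPoisson {Ω : Type*} [MeasurableSpace Ω] (μ : Measure Ω)
    (X : ℕ → Ω → Plane) (lam : ℝ) : Prop where
  measurable : ∀ n, Measurable (X n)
  count_law : ∀ B : Set Plane, MeasurableSet B → volume B < ⊤ → ∀ k : ℕ,
    μ.real {ω | count X B ω = k} =
      Real.exp (-(lam * volume.real B)) * (lam * volume.real B) ^ k / (k.factorial : ℝ)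
  count_indep : ∀ (m : ℕ) (B : Fin m → Set Plane), (∀ j, MeasurableSet (B j)) →
    (∀ j, volume (B j) < ⊤) → Pairwise (fun j k => Disjoint (B j) (B k)) →
    iIndepFun (fun j => count X (B j)) μ

/-- The marks `T 0, T 1, …` label the points `X 0, X 1, …` independently: given all the
positions, the marks are mutually independent, and a point at position `x` receives the
mark `i` with probability `q i x`. -/
structure IsIndependentMarking {Ω : Type*} [MeasurableSpace Ω] (μ : Measure Ω)
    (X : ℕ → Ω → Plane) (T : ℕ → Ω → LinkState) (q : LinkState → Plane → ℝ) : Prop where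
  measurable : ∀ n, Measurable (T n)
  cond_law : ∀ (F : Finset ℕ) (t : ℕ → LinkState),
    μ⟦{ω | ∀ n ∈ F, T n ω = t n} |
        MeasurableSpace.comap (fun ω n => X n ω) (inferInstance : MeasurableSpace (ℕ → Plane))⟧
      =ᵐ[μ] fun ω => ∏ n ∈ F, q (t n) (X n ω)

/-- Probability that a UAV at altitude `h` and at (three-dimensional) distance `r` from the UE
is in line of sight; `C` and `Y` are the environment parameters. -/
def losProb (h C Y r : ℝ) : ℝ :=
  1 / (1 + C * Real.exp (-(Y * (Real.arcsin (h / r) * (180 / Real.pi) - C))))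

/-- Distance from the UE of a UAV at altitude `h` whose horizontal distance is `ρ`. -/
def slant (h ρ : ℝ) : ℝ := Real.sqrt (ρ ^ 2 + h ^ 2)

/-- `p_i(ρ)`: probability of link state `i` at horizontal distance `ρ`. -/
def stateProb (h C Y : ℝ) (i : LinkState) (ρ : ℝ) : ℝ :=
  match i with
  | .los => losProb h C Y (slant h ρ)
  | .nlos => 1 - losProb h C Y (slant h ρ)

/-- `b(r) = √(r² - h²)`, the horizontal distance corresponding to distance `r`.
It is `0` if `0 ≤ r ≤ h` (no UAV is closer to the UE than `h`). -/
def horiz (h r : ℝ) : ℝ := Real.sqrt (r ^ 2 - h ^ 2)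

/-- Path gain `ℓ_i(r) = G_i r^{-a_i}` (`G i` is the gain at unit distance, `a i` the exponent). -/
def pathGain (G a : LinkState → ℝ) (i : LinkState) (r : ℝ) : ℝ := G i * r ^ (-(a i))

/-- UAV `n` attains the maximum path gain among all UAVs, for the configuration of positions `x`
and link states `t`. -/
def IsServing (h : ℝ) (G a : LinkState → ℝ) (x : ℕ → Plane) (t : ℕ → LinkState) (n : ℕ) : Prop :=
  ∀ m : ℕ, pathGain G a (t m) (slant h ‖x m‖) ≤ pathGain G a (t n) (slant h ‖x n‖)

/-- The event that the UE connects to a UAV with link state `i`. -/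
def connects {Ω : Type*} (h : ℝ) (G a : LinkState → ℝ) (X : ℕ → Ω → Plane)
    (T : ℕ → Ω → LinkState) (i : LinkState) : Set Ω :=
  {ω | ∃ n : ℕ, T n ω = i ∧ IsServing h G a (fun m => X m ω) (fun m => T m ω) n}

/-- `A_i(r) = ((G_{i*} / G_i) r^{a_i})^{1 / a_{i*}}`. -/
def exclusionDist (G a : LinkState → ℝ) (i : LinkState) (r : ℝ) : ℝ :=
  (G i.opp / G i * r ^ (a i)) ^ (1 / a i.opp)

/-- `exp(-2πλ ∫_0^s p_i(ρ) ρ dρ)`. -/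
def voidProb (h C Y lam : ℝ) (i : LinkState) (s : ℝ) : ℝ :=
  Real.exp (-(2 * Real.pi * lam * ∫ ρ in (0 : ℝ)..s, stateProb h C Y i ρ * ρ))

/-- `f_i(r)`: density of the distance from the UE to the closest UAV with link state `i`. -/
def nearestDensity (h C Y lam : ℝ) (i : LinkState) (r : ℝ) : ℝ :=
  2 * Real.pi * lam * r * stateProb h C Y i (horiz h r) * voidProb h C Y lam i (horiz h r)

end UAV

end

open Filter Topology
open scoped NNReal ENNReal

namespace UAV

/-! ### Poisson counts and the generating functional of step functions -/

section Poisson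

variable {Ω : Type*} [MeasurableSpace Ω] {μ : Measure Ω} {X : ℕ → Ω → Plane} {lam : ℝ}

/-! Let R_i be the horizontal distance of the closest UAV in state i. Path gain decreases with
distance, so almost surely the UE connects to state i exactly when the closest UAV in state i has
gain at least that of the closest one in state i*. In terms of distances this reads b(A_i(√(R_i² +
h²))) ≤ R_{i*} (`mem_connects_iff`). It remains to find the joint law of R_i and R_{i*}.

That law comes from void probabilities. The probability that no point with mark j falls in D_j, for
both j, is exp(-λ ∑_j ∫_{D_j} q_j) (`measureReal_forall_notMem`). Conditioning on the positions
reduces it to the Poisson generating functional E ∏ (1 - u(X_n)) = exp(-λ ∫ u), which follows from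
the count laws for step functions and by squeezing in general.

For discs D_j the exponential factors over the states, so R_i and R_{i*} are independent with tails
`voidProb`; differentiating the tail gives the density of R_i. Fubini then yields an integral over
ρ, and the substitution r = √(ρ² + h²) turns it into the stated one. -/

lemma natCast_le_encard_iff {α : Type*} {s : Set α} {k : ℕ} :
    (k : ℕ∞) ≤ s.encard ↔ ∃ F : Finset α, F.card = k ∧ (F : Set α) ⊆ s := by
  constructor
  · intro hk
    obtain ⟨t, hts, ht⟩ := Set.exists_subset_encard_eq hk
    have hfin : t.Finite := Set.finite_of_encard_eq_coe ht
    refine ⟨hfin.toFinset, ?_, by simpa using hts⟩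
    rw [hfin.encard_eq_coe_toFinset_card] at ht
    exact_mod_cast ht
  · rintro ⟨F, rfl, hF⟩
    rw [← Set.encard_coe_eq_coe_finsetCard]
    exact Set.encard_le_encard hF

/-- Having at least k points in B means that some k-element set of indices has all its points in B,
which is a countable union of measurable events. -/
lemma measurable_count (hX : ∀ n, Measurable (X n)) {B : Set Plane} (hB : MeasurableSet B) :
    Measurable (count X B) := by
  have hle : ∀ k : ℕ, MeasurableSet {ω | (k : ℕ∞) ≤ count X B ω} := by
    intro k
    have : {ω | (k : ℕ∞) ≤ count X B ω} =
        ⋃ F : Finset ℕ, ⋃ _ : F.card = k, ⋂ n ∈ F, X n ⁻¹' B := by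
      ext ω
      simp only [count, mem_ofPred_eq, natCast_le_encard_iff, mem_iUnion, mem_iInter, mem_preimage,
        exists_prop, subset_def, Finset.mem_coe]
    rw [this]
    exact .iUnion fun F => .iUnion fun _ => Finset.measurableSet_biInter _ fun n _ => hX n hB
  rw [ENat.measurable_iff]
  intro k
  have : count X B ⁻¹' {(k : ℕ∞)} =
      {ω | (k : ℕ∞) ≤ count X B ω} \ {ω | ((k + 1 : ℕ) : ℕ∞) ≤ count X B ω} := by
    ext ω
    simp only [mem_preimage, mem_singleton_iff, Set.mem_sdiff, mem_ofPred_eq, not_le]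
    rw [Nat.cast_add, Nat.cast_one, ENat.lt_add_one_iff (by simp)]
    exact ⟨fun h => ⟨h.ge, h.le⟩, fun h => le_antisymm h.2 h.1⟩
  rw [this]
  exact (hle k).diff (hle (k + 1))

/-- The hypothesis prescribes only the masses of finite counts. They already sum to one, so none is
left for `⊤`. -/
lemma map_count [IsProbabilityMeasure μ] (hX : IsHomogeneousPoisson μ X lam) (hlam : 0 < lam)
    {B : Set Plane} (hB : MeasurableSet B) (hv : volume B < ⊤) :
    μ.map (count X B) =
      (poissonMeasure (lam * volume.real B).toNNReal).map (fun n : ℕ => (n : ℕ∞)) := by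
  have hN := measurable_count hX.measurable hB
  have hc : Measurable (fun n : ℕ => (n : ℕ∞)) := measurable_from_top
  set ν := (poissonMeasure (lam * volume.real B).toNNReal).map (fun n : ℕ => (n : ℕ∞)) with hν
  have hinj : Function.Injective (fun n : ℕ => (n : ℕ∞)) := Nat.cast_injective
  have : IsProbabilityMeasure (μ.map (count X B)) := Measure.isProbabilityMeasure_map hN.aemeasurable
  have : IsProbabilityMeasure ν := Measure.isProbabilityMeasure_map hc.aemeasurable
  have hm : 0 ≤ lam * volume.real B := mul_nonneg hlam.le measureReal_nonneg
  have hk : ∀ k : ℕ, μ.map (count X B) {(k : ℕ∞)} = ν {(k : ℕ∞)} := by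
    intro k
    rw [← measureReal_eq_measureReal_iff, hν, map_measureReal_apply hN (measurableSet_singleton _),
      map_measureReal_apply hc (measurableSet_singleton _)]
    have h1 : (fun n : ℕ => (n : ℕ∞)) ⁻¹' {(k : ℕ∞)} = {k} := by ext; simp
    rw [h1, poissonMeasure_real_singleton]
    have := hX.count_law B hB hv k
    rw [Real.coe_toNNReal _ hm]
    exact this
  have hdisj : Pairwise (Function.onFun Disjoint fun k : ℕ => ({(k : ℕ∞)} : Set ℕ∞)) := by
    intro a b hab
    simpa [Function.onFun] using hab
  have hr : μ.map (count X B) (⋃ k : ℕ, {(k : ℕ∞)}) = ν (⋃ k : ℕ, {(k : ℕ∞)}) := by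
    rw [measure_iUnion hdisj fun _ => measurableSet_singleton _,
      measure_iUnion hdisj fun _ => measurableSet_singleton _]
    exact tsum_congr hk
  refine Measure.ext_of_singleton fun a => ?_
  induction a using ENat.recTopCoe with
  | coe k => exact hk k
  | top =>
    have h1 : ({⊤} : Set ℕ∞) = (⋃ k : ℕ, {(k : ℕ∞)})ᶜ := by
      ext a
      induction a using ENat.recTopCoe <;> simp
    rw [h1, prob_compl_eq_one_sub (by measurability), prob_compl_eq_one_sub (by measurability), hr]

lemma ae_count_ne_top [IsProbabilityMeasure μ] (hX : IsHomogeneousPoisson μ X lam)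
    (hlam : 0 < lam) {B : Set Plane} (hB : MeasurableSet B) (hv : volume B < ⊤) :
    ∀ᵐ ω ∂μ, count X B ω ≠ ⊤ := by
  have hN := measurable_count hX.measurable hB
  rw [← ae_map_iff (p := fun a : ℕ∞ => a ≠ ⊤) hN.aemeasurable (MeasurableSet.of_discrete),
    map_count hX hlam hB hv, ae_map_iff (measurable_from_top).aemeasurable MeasurableSet.of_discrete]
  simp

lemma integral_pow_count [IsProbabilityMeasure μ] (hX : IsHomogeneousPoisson μ X lam)
    (hlam : 0 < lam) {B : Set Plane} (hB : MeasurableSet B) (hv : volume B < ⊤) (c : ℝ) :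
    ∫ ω, c ^ (count X B ω).toNat ∂μ = Real.exp (-(lam * (volume.real B * (1 - c)))) := by
  have hN := measurable_count hX.measurable hB
  have hm : 0 ≤ lam * volume.real B := mul_nonneg hlam.le measureReal_nonneg
  rw [← integral_map (f := fun a : ℕ∞ => c ^ a.toNat) hN.aemeasurable
    (measurable_from_top).aestronglyMeasurable, map_count hX hlam hB hv,
    integral_map (measurable_from_top).aemeasurable (measurable_from_top).aestronglyMeasurable,
    integral_poissonMeasure, Real.coe_toNNReal _ hm]
  simp only [ENat.toNat_natCast, smul_eq_mul]
  have h1 := (NormedSpace.expSeries_div_hasSum_exp (𝔸 := ℝ) (lam * volume.real B * c)).mul_left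
    (Real.exp (-(lam * volume.real B)))
  rw [← Real.exp_eq_exp_ℝ, ← Real.exp_add] at h1
  convert h1.tsum_eq using 1
  · refine tsum_congr fun k => ?_
    rw [mul_pow]; ring
  · congr 1; ring

lemma tendsto_prod_ite_mem {α : Type*} (x : ℕ → α) (B : Set α) [DecidablePred (· ∈ B)] (c : ℝ)
    (hfin : {n | x n ∈ B}.encard ≠ ⊤) :
    Tendsto (fun M => ∏ n ∈ Finset.range M, (if x n ∈ B then c else 1)) atTop
      (𝓝 (c ^ ({n | x n ∈ B}.encard).toNat)) := by
  have hS : {n | x n ∈ B}.Finite := Set.encard_ne_top_iff.1 hfin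
  obtain ⟨M₀, hM₀⟩ := hS.bddAbove
  refine tendsto_const_nhds.congr' ?_
  filter_upwards [eventually_gt_atTop M₀] with M hM
  rw [← Finset.prod_filter, Finset.prod_const, hS.encard_eq_coe_toFinset_card, ENat.toNat_natCast]
  congr 2
  ext n
  simp only [Finite.mem_toFinset, mem_ofPred_eq, Finset.mem_filter, Finset.mem_range]
  exact ⟨fun h => ⟨(hM₀ h).trans_lt hM, h⟩, fun h => h.2⟩

open scoped Classical in
-- The full product is ∏ j, c j ^ N_j with N_j the number of points in B j. The N_j are independent,
-- so its mean is a product of Poisson generating functions. Almost surely the N_j are finite and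
-- the partial products are eventually constant; dominated convergence applies.
lemma tendsto_integral_prod_step [IsProbabilityMeasure μ] (hX : IsHomogeneousPoisson μ X lam)
    (hlam : 0 < lam) {m : ℕ} {B : Fin m → Set Plane} (hB : ∀ j, MeasurableSet (B j))
    (hv : ∀ j, volume (B j) < ⊤) (hd : Pairwise fun j k => Disjoint (B j) (B k))
    {c : Fin m → ℝ} (hc0 : ∀ j, 0 ≤ c j) (hc1 : ∀ j, c j ≤ 1) :
    Tendsto (fun M => ∫ ω, ∏ n ∈ Finset.range M, ∏ j, (if X n ω ∈ B j then c j else 1) ∂μ) atTop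
      (𝓝 (Real.exp (-(lam * ∑ j, volume.real (B j) * (1 - c j))))) := by
  have hlim : ∫ ω, ∏ j, c j ^ (count X (B j) ω).toNat ∂μ =
      Real.exp (-(lam * ∑ j, volume.real (B j) * (1 - c j))) := by
    rw [(hX.count_indep m B hB hv hd).integral_fun_prod_comp
      (f := fun j (a : ℕ∞) => c j ^ a.toNat)
      (fun j => (measurable_count hX.measurable (hB j)).aemeasurable)
      (fun j => (measurable_from_top).aestronglyMeasurable)]
    rw [Finset.mul_sum, ← Finset.sum_neg_distrib, Real.exp_sum]
    exact Finset.prod_congr rfl fun j _ => integral_pow_count hX hlam (hB j) (hv j) (c j)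
  rw [← hlim]
  refine tendsto_integral_of_dominated_convergence (fun _ => 1) ?_ (integrable_const _) ?_ ?_
  · intro M
    refine Measurable.aestronglyMeasurable ?_
    refine Finset.measurable_fun_prod _ fun n _ => Finset.measurable_fun_prod _ fun j _ => ?_
    exact Measurable.ite (hX.measurable n (hB j)) measurable_const measurable_const
  · intro M
    refine ae_of_all _ fun ω => ?_
    have h0 : ∀ n j, 0 ≤ (if X n ω ∈ B j then c j else 1) := fun n j => by
      split_ifs; exacts [hc0 j, zero_le_one]
    have h1 : ∀ n j, (if X n ω ∈ B j then c j else 1) ≤ 1 := fun n j => by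
      split_ifs; exacts [hc1 j, le_rfl]
    rw [Real.norm_of_nonneg (Finset.prod_nonneg fun n _ => Finset.prod_nonneg fun j _ => h0 n j)]
    exact Finset.prod_le_one (fun n _ => Finset.prod_nonneg fun j _ => h0 n j)
      fun n _ => Finset.prod_le_one (fun j _ => h0 n j) fun j _ => h1 n j
  · filter_upwards [ae_all_iff.2 fun j => ae_count_ne_top hX hlam (hB j) (hv j)] with ω hω
    simp_rw [Finset.prod_comm (s := Finset.range _)]
    exact tendsto_finsetProd _ fun j _ => tendsto_prod_ite_mem (fun n => X n ω) (B j) (c j) (hω j)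

end Poisson

/-! ### Level sets used to discretise a function with values in [0, 1] -/

section Levels

/-- The part of `B` on which `u` lies in `[j / K, (j + 1) / K)`. -/
def level (u : Plane → ℝ) (B : Set Plane) (K j : ℕ) : Set Plane := {x ∈ B | ⌊K * u x⌋₊ = j}

variable {u : Plane → ℝ} {B : Set Plane} {K : ℕ}

lemma measurableSet_level (hu : Measurable u) (hB : MeasurableSet B) (K j : ℕ) :
    MeasurableSet (level u B K j) :=
  hB.inter ((Nat.measurable_floor.comp (measurable_const.mul hu)) (measurableSet_singleton j))

lemma level_subset (u : Plane → ℝ) (B : Set Plane) (K j : ℕ) : level u B K j ⊆ B := fun _ hx => hx.1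

lemma disjoint_level {j k : ℕ} (hjk : j ≠ k) : Disjoint (level u B K j) (level u B K k) :=
  Set.disjoint_left.2 fun _ hx hx' => hjk (hx.2.symm.trans hx'.2)

/-- The value u = 1 has floor K, hence K + 1 levels and not K. -/
lemma floor_lt_of_le_one (hu1 : ∀ x, u x ≤ 1) (K : ℕ) (x : Plane) : ⌊K * u x⌋₊ < K + 1 := by
  refine Nat.lt_succ_of_le (Nat.floor_le_of_le ?_)
  exact mul_le_of_le_one_right K.cast_nonneg (hu1 x)

lemma iUnion_level (hu1 : ∀ x, u x ≤ 1) : ⋃ j : Fin (K + 1), level u B K j = B := by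
  refine subset_antisymm (iUnion_subset fun j => level_subset u B K j) fun x hx => ?_
  exact mem_iUnion.2 ⟨⟨_, floor_lt_of_le_one hu1 K x⟩, hx, rfl⟩

open scoped Classical in
lemma prod_ite_mem_level (hu1 : ∀ x, u x ≤ 1) (c : ℕ → ℝ) (x : Plane) :
    ∏ j : Fin (K + 1), (if x ∈ level u B K j then c j else 1) =
      if x ∈ B then c ⌊K * u x⌋₊ else 1 := by
  split_ifs with hx
  · rw [Finset.prod_eq_single ⟨_, floor_lt_of_le_one hu1 K x⟩]
    · rw [if_pos ⟨hx, rfl⟩]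
    · intro j _ hj
      exact if_neg fun h => hj (Fin.ext h.2.symm)
    · simp
  · exact Finset.prod_eq_one fun j _ => if_neg fun h => hx h.1

lemma sum_volume_level (hu : Measurable u) (hu1 : ∀ x, u x ≤ 1) (hB : MeasurableSet B)
    (hv : volume B < ⊤) : ∑ j : Fin (K + 1), volume.real (level u B K j) = volume.real B := by
  rw [← measureReal_iUnion_fintype (fun j k hjk => disjoint_level fun h => hjk (Fin.ext h))
    (fun j => measurableSet_level hu hB K j)
    (fun j => (measure_mono (level_subset u B K j)).trans_lt hv |>.ne), iUnion_level hu1]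

lemma level_integral_bounds (hu : Measurable u) (hu0 : ∀ x, 0 ≤ u x) (hu1 : ∀ x, u x ≤ 1)
    (hB : MeasurableSet B) (hv : volume B < ⊤) (hK : 0 < K) (j : ℕ) :
    volume.real (level u B K j) * (j / K) ≤ ∫ x in level u B K j, u x ∧
      ∫ x in level u B K j, u x ≤ volume.real (level u B K j) * ((j + 1) / K) := by
  have hK' : (0 : ℝ) < K := Nat.cast_pos.2 hK
  have hm := measurableSet_level hu hB K j
  have hfin : volume (level u B K j) < ⊤ := (measure_mono (level_subset u B K j)).trans_lt hv
  have hi : IntegrableOn u (level u B K j) := by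
    refine Measure.integrableOn_of_bounded (M := 1) hfin.ne hu.aestronglyMeasurable ?_
    exact ae_of_all _ fun x => by rw [Real.norm_of_nonneg (hu0 x)]; exact hu1 x
  have hc : ∀ c : ℝ, ∫ _ in level u B K j, c = volume.real (level u B K j) * c := fun c => by
    rw [setIntegral_const, smul_eq_mul]
  rw [← hc, ← hc]
  constructor
  · refine setIntegral_mono_on (integrableOn_const hfin.ne) hi hm fun x hx => ?_
    rw [div_le_iff₀' hK', ← hx.2]
    exact Nat.floor_le (mul_nonneg hK'.le (hu0 x))
  · refine setIntegral_mono_on hi (integrableOn_const hfin.ne) hm fun x hx => ?_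
    rw [le_div_iff₀' hK', ← hx.2]
    exact (Nat.lt_floor_add_one _).le

lemma integral_eq_sum_level (hu : Measurable u) (hu0 : ∀ x, 0 ≤ u x) (hu1 : ∀ x, u x ≤ 1)
    (hB : MeasurableSet B) (hv : volume B < ⊤) (huB : ∀ x ∉ B, u x = 0) :
    ∫ x, u x = ∑ j : Fin (K + 1), ∫ x in level u B K j, u x := by
  have hi : IntegrableOn u B := by
    refine Measure.integrableOn_of_bounded (M := 1) hv.ne hu.aestronglyMeasurable ?_
    exact ae_of_all _ fun x => by rw [Real.norm_of_nonneg (hu0 x)]; exact hu1 x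
  rw [← setIntegral_eq_integral_of_forall_compl_eq_zero huB, ← integral_iUnion_fintype
    (s := fun j : Fin (K + 1) => level u B K j) (fun j => measurableSet_level hu hB K j)
    (fun j k hjk => disjoint_level fun h => hjk (Fin.ext h))
    (fun j => hi.mono_set (level_subset u B K j)), iUnion_level hu1]

end Levels

/-! ### Generating functional of the Poisson process -/

section Thinning

variable {Ω : Type*} [MeasurableSpace Ω] {μ : Measure Ω} {X : ℕ → Ω → Plane} {lam : ℝ}

/-- The generating functional of a homogeneous Poisson point process. -/
theorem tendsto_integral_prod_one_sub [IsProbabilityMeasure μ]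
    (hX : IsHomogeneousPoisson μ X lam) (hlam : 0 < lam) {u : Plane → ℝ} (hu : Measurable u)
    (hu0 : ∀ x, 0 ≤ u x) (hu1 : ∀ x, u x ≤ 1) {B : Set Plane} (hB : MeasurableSet B)
    (hv : volume B < ⊤) (huB : ∀ x ∉ B, u x = 0) :
    Tendsto (fun M => ∫ ω, ∏ n ∈ Finset.range M, (1 - u (X n ω)) ∂μ) atTop
      (𝓝 (Real.exp (-(lam * ∫ x, u x)))) := by
  classical
  have hint : ∀ {v : Plane → ℝ}, Measurable v → (∀ x, 0 ≤ v x) → (∀ x, v x ≤ 1) → ∀ M,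
      Integrable (fun ω => ∏ n ∈ Finset.range M, v (X n ω)) μ := by
    intro v hv hv0 hv1 M
    refine Integrable.of_bound (Finset.measurable_fun_prod _ fun n _ =>
      hv.comp (hX.measurable n)).aestronglyMeasurable 1 (ae_of_all _ fun ω => ?_)
    rw [Real.norm_of_nonneg (Finset.prod_nonneg fun n _ => hv0 _)]
    exact Finset.prod_le_one (fun n _ => hv0 _) fun n _ => hv1 _
  have hstep : ∀ (K : ℕ) (c : ℕ → ℝ), (∀ j, j ≤ K → 0 ≤ c j) → (∀ j, c j ≤ 1) →
      Tendsto (fun M => ∫ ω, ∏ n ∈ Finset.range M,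
        (if X n ω ∈ B then c ⌊K * u (X n ω)⌋₊ else 1) ∂μ) atTop
      (𝓝 (Real.exp (-(lam * ∑ j : Fin (K + 1), volume.real (level u B K j) * (1 - c j))))) := by
    intro K c h0 h1
    simp_rw [← prod_ite_mem_level hu1]
    exact tendsto_integral_prod_step hX hlam (fun j => measurableSet_level hu hB K j)
      (fun j => (measure_mono (level_subset u B K j)).trans_lt hv)
      (fun j k hjk => disjoint_level fun h => hjk (Fin.ext h))
      (fun j => h0 j (Nat.le_of_lt_succ j.2)) fun j => h1 j
  have hmeas : ∀ (K : ℕ) (c : ℕ → ℝ),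
      Measurable fun x => if x ∈ B then c ⌊K * u x⌋₊ else 1 := fun K c =>
    Measurable.ite hB (measurable_from_top.comp
      (Nat.measurable_floor.comp (measurable_const.mul hu))) measurable_const
  have hsum := fun K => sum_volume_level (K := K) hu hu1 hB hv
  -- Rounding u to multiples of 1/K costs at most vol(B)/K in the integral. The sign s is 1 for the
  -- lower comparison and -1 for the upper one; the shift to K + 1 avoids division by zero.
  have hlim : ∀ s : ℝ, Tendsto (fun K : ℕ => Real.exp (-(lam * ((∫ x, u x) +
      s * (volume.real B * (1 / ((K : ℝ) + 1))))))) atTop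
      (𝓝 (Real.exp (-(lam * ∫ x, u x)))) := by
    intro s
    have := tendsto_one_div_add_atTop_nhds_zero_nat (𝕜 := ℝ)
    have h2 := ((((this.const_mul (volume.real B)).const_mul s).const_add
      (∫ x, u x)).const_mul lam).neg.rexp
    simpa using h2
  refine tendsto_order.2 ⟨fun a ha => ?_, fun a ha => ?_⟩
  · obtain ⟨k, hk⟩ := ((tendsto_order.1 (hlim 1)).1 a ha).exists
    set K := k + 1 with hKdef
    have hK : 0 < K := Nat.succ_pos k
    have hK' : (0 : ℝ) < K := Nat.cast_pos.2 hK
    -- On level j, u < (j + 1)/K, so c j lies below 1 - u. The truncation matters at the top level j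
    -- = K, where 1 - (j + 1)/K is negative.
    set c : ℕ → ℝ := fun j => max 0 (1 - ((j : ℝ) + 1) / K) with hc
    have hc0 : ∀ j, 0 ≤ c j := fun j => le_max_left _ _
    have hc1 : ∀ j, c j ≤ 1 := fun j => max_le zero_le_one (by
      have : 0 ≤ ((j : ℝ) + 1) / K := by positivity
      linarith)
    have hbound : ∑ j : Fin (K + 1), volume.real (level u B K j) * (1 - c j) ≤
        (∫ x, u x) + 1 * (volume.real B * (1 / ((k : ℝ) + 1))) := by
      rw [integral_eq_sum_level (K := K) hu hu0 hu1 hB hv huB, ← hsum K, one_mul, Finset.sum_mul,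
        ← Finset.sum_add_distrib]
      refine Finset.sum_le_sum fun j _ => ?_
      have h1 := (level_integral_bounds hu hu0 hu1 hB hv hK j).1
      have h2 : 1 - c j ≤ (j : ℝ) / K + 1 / K := by
        have := le_max_right 0 (1 - ((j : ℝ) + 1) / K)
        rw [← add_div]
        simp only [hc]
        linarith
      have h3 := mul_le_mul_of_nonneg_left h2
        (measureReal_nonneg (μ := volume) (s := level u B K j))
      rw [mul_add] at h3
      have h4 : (K : ℝ) = (k : ℝ) + 1 := by push_cast [hKdef]; rfl
      rw [← h4]
      linarith
    have h5 : a < Real.exp (-(lam * ∑ j : Fin (K + 1), volume.real (level u B K j) * (1 - c j))) :=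
      hk.trans_le (Real.exp_le_exp.2 (neg_le_neg (mul_le_mul_of_nonneg_left hbound hlam.le)))
    filter_upwards [(tendsto_order.1 (hstep K c (fun j _ => hc0 j) hc1)).1 a h5] with M hM
    refine hM.trans_le ?_
    refine integral_mono (hint (hmeas K c) (fun x => ?_) (fun x => ?_) M)
      (hint (measurable_const.sub hu) (fun x => sub_nonneg.2 (hu1 x))
        (fun x => sub_le_self _ (hu0 x)) M) fun ω => ?_
    · split_ifs; exacts [hc0 _, zero_le_one]
    · split_ifs; exacts [hc1 _, le_rfl]
    · refine Finset.prod_le_prod (fun n _ => ?_) fun n _ => ?_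
      · split_ifs; exacts [hc0 _, zero_le_one]
      · split_ifs with hx
        · refine max_le (sub_nonneg.2 (hu1 _)) ?_
          rw [sub_le_sub_iff_left, le_div_iff₀' hK']
          exact (Nat.lt_floor_add_one _).le
        · rw [huB _ hx, sub_zero]
  · obtain ⟨k, hk⟩ := ((tendsto_order.1 (hlim (-1))).2 a ha).exists
    set K := k + 1 with hKdef
    have hK : 0 < K := Nat.succ_pos k
    have hK' : (0 : ℝ) < K := Nat.cast_pos.2 hK
    -- On level j, u ≥ j/K, so c j lies above 1 - u. For j ≤ K the truncation is inactive and 1 - c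
    -- j = j/K.
    set c : ℕ → ℝ := fun j => max 0 (1 - (j : ℝ) / K) with hc
    have hc0 : ∀ j, 0 ≤ c j := fun j => le_max_left _ _
    have hc1 : ∀ j, c j ≤ 1 := fun j => max_le zero_le_one (by
      have : 0 ≤ (j : ℝ) / K := by positivity
      linarith)
    have hbound : (∫ x, u x) + -1 * (volume.real B * (1 / ((k : ℝ) + 1))) ≤
        ∑ j : Fin (K + 1), volume.real (level u B K j) * (1 - c j) := by
      rw [integral_eq_sum_level (K := K) hu hu0 hu1 hB hv huB, ← hsum K, Finset.sum_mul,
        Finset.mul_sum, ← Finset.sum_add_distrib]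
      refine Finset.sum_le_sum fun j _ => ?_
      have h1 := (level_integral_bounds hu hu0 hu1 hB hv hK j).2
      have h2 : (j : ℝ) / K = 1 - c j := by
        have : (j : ℝ) / K ≤ 1 := by
          rw [div_le_one hK']
          exact_mod_cast Nat.le_of_lt_succ j.2
        simp only [hc]
        rw [max_eq_right (by linarith)]
        ring
      have h4 : (K : ℝ) = (k : ℝ) + 1 := by push_cast [hKdef]; rfl
      rw [← h4, ← h2]
      rw [add_div, mul_add] at h1
      linarith
    have h5 : Real.exp (-(lam * ∑ j : Fin (K + 1), volume.real (level u B K j) * (1 - c j))) < a :=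
      (Real.exp_le_exp.2 (neg_le_neg (mul_le_mul_of_nonneg_left hbound hlam.le))).trans_lt hk
    filter_upwards [(tendsto_order.1 (hstep K c (fun j _ => hc0 j) hc1)).2 a h5] with M hM
    refine lt_of_le_of_lt ?_ hM
    refine integral_mono
      (hint (measurable_const.sub hu) (fun x => sub_nonneg.2 (hu1 x))
        (fun x => sub_le_self _ (hu0 x)) M)
      (hint (hmeas K c) (fun x => ?_) (fun x => ?_) M) fun ω => ?_
    · split_ifs; exacts [hc0 _, zero_le_one]
    · split_ifs; exacts [hc1 _, le_rfl]
    · refine Finset.prod_le_prod (fun n _ => sub_nonneg.2 (hu1 _)) fun n _ => ?_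
      split_ifs with hx
      · refine le_max_of_le_right ?_
        rw [sub_le_sub_iff_left, div_le_iff₀' hK']
        exact Nat.floor_le (mul_nonneg hK'.le (hu0 _))
      · exact sub_le_self _ (hu0 _)

end Thinning

/-! ### The two link states -/

instance : DecidableEq LinkState := fun i j => by
  cases i <;> cases j <;> first | exact isTrue rfl | exact isFalse (fun h => by cases h)

instance : Fintype LinkState := ⟨{.los, .nlos}, fun i => by cases i <;> simp⟩

instance : MeasurableSingletonClass LinkState := ⟨fun _ => trivial⟩

lemma sum_linkState (f : LinkState → ℝ) (i : LinkState) : ∑ j, f j = f i + f i.opp := by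
  have : ∑ j, f j = f .los + f .nlos := Finset.sum_pair (by decide)
  cases i
  · exact this
  · rw [this, add_comm]; rfl

lemma LinkState.opp_ne (i : LinkState) : i.opp ≠ i := by cases i <;> decide

lemma LinkState.eq_opp_of_ne {i j : LinkState} (h : j ≠ i) : j = i.opp := by
  cases i <;> cases j <;> first | rfl | exact absurd rfl h

/-! ### Void probabilities under independent marking -/

section Marking

variable {Ω : Type*} [MeasurableSpace Ω] {μ : Measure Ω} {X : ℕ → Ω → Plane}
  {T : ℕ → Ω → LinkState} {lam : ℝ} {q : LinkState → Plane → ℝ}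

lemma measurableSet_notMem (hX : ∀ n, Measurable (X n)) (hT : ∀ n, Measurable (T n))
    {D : LinkState → Set Plane} (hD : ∀ i, MeasurableSet (D i)) (n : ℕ) :
    MeasurableSet {ω | X n ω ∉ D (T n ω)} := by
  have : {ω | X n ω ∉ D (T n ω)} = ⋃ i, T n ⁻¹' {i} ∩ X n ⁻¹' (D i)ᶜ := by
    ext ω; simp
  rw [this]
  exact .iUnion fun i => (hT n (measurableSet_singleton i)).inter (hX n (hD i).compl)

open scoped Classical in
-- The condition on the positions is measurable for the conditioning σ-algebra, so the conditional
-- law of the marks can be integrated over it.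
lemma measureReal_marks_inter [IsProbabilityMeasure μ] (hX : ∀ n, Measurable (X n))
    (hT : IsIndependentMarking μ X T q) {D : LinkState → Set Plane}
    (hD : ∀ i, MeasurableSet (D i)) (M : ℕ) (p : Fin M → LinkState) :
    μ.real {ω | ∀ n : Fin M, T n ω = p n ∧ X n ω ∉ D (p n)} =
      ∫ ω, ∏ n : Fin M, (if X n ω ∈ D (p n) then 0 else q (p n) (X n ω)) ∂μ := by
  -- `cond_law` expects marks for all indices; the value beyond M is irrelevant.
  set t : ℕ → LinkState := fun n => if hn : n < M then p ⟨n, hn⟩ else .los with ht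
  have htp : ∀ n : Fin M, t n = p n := fun n => by simp [ht]
  set A : Set Ω := {ω | ∀ n ∈ Finset.range M, T n ω = t n} with hA
  set S : Set Ω := {ω | ∀ n : Fin M, X n ω ∉ D (p n)} with hS
  have hmle : MeasurableSpace.comap (fun ω n => X n ω)
      (inferInstance : MeasurableSpace (ℕ → Plane)) ≤ ‹MeasurableSpace Ω› :=
    (measurable_pi_lambda _ hX).comap_le
  have hAm : MeasurableSet A := by
    have : A = ⋂ n ∈ Finset.range M, T n ⁻¹' {t n} := by ext ω; simp [hA]
    rw [this]
    exact Finset.measurableSet_biInter _ fun n _ => hT.measurable n (measurableSet_singleton _)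
  have hSm : MeasurableSet[MeasurableSpace.comap (fun ω n => X n ω)
      (inferInstance : MeasurableSpace (ℕ → Plane))] S := by
    refine ⟨{x | ∀ n : Fin M, x n ∉ D (p n)}, ?_, rfl⟩
    have : {x : ℕ → Plane | ∀ n : Fin M, x n ∉ D (p n)} =
        ⋂ n : Fin M, (fun x : ℕ → Plane => x n) ⁻¹' (D (p n))ᶜ := by ext; simp
    rw [this]
    exact .iInter fun n => measurable_pi_apply _ (hD (p n)).compl
  have hSm' : MeasurableSet S := hmle _ hSm
  have hset : {ω | ∀ n : Fin M, T n ω = p n ∧ X n ω ∉ D (p n)} = A ∩ S := by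
    ext ω
    simp only [mem_ofPred_eq, hA, hS, mem_inter_iff, forall_and, Finset.mem_range]
    refine and_congr_left fun _ => ⟨fun h n hn => ?_, fun h n => ?_⟩
    · rw [h ⟨n, hn⟩, ← htp]
    · rw [h n n.2, htp]
  have hint : Integrable (A.indicator fun _ => (1 : ℝ)) μ := (integrable_const 1).indicator hAm
  have hcond := setIntegral_condExp hmle hint hSm
  rw [setIntegral_indicator hAm, setIntegral_const, smul_eq_mul, mul_one, inter_comm] at hcond
  rw [hset, ← hcond, setIntegral_congr_ae hSm' ((hT.cond_law (Finset.range M) t).mono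
    fun ω hω _ => hω), ← integral_indicator hSm']
  refine integral_congr_ae (ae_of_all _ fun ω => ?_)
  dsimp only
  by_cases hω : ω ∈ S
  · rw [indicator_of_mem hω, Finset.prod_range]
    exact Finset.prod_congr rfl fun n _ => by rw [htp, if_neg (hω n)]
  · rw [indicator_of_notMem hω]
    simp only [hS, mem_ofPred_eq, not_forall, not_not] at hω
    obtain ⟨n, hn⟩ := hω
    exact (Finset.prod_eq_zero (Finset.mem_univ n) (by rw [if_pos hn])).symm

/-- Sum over all patterns of the first M marks. The sum of products is the product over n of the
sums over marks, and since the q i add up to 1 each factor is the conditional probability that point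
n is not in its forbidden set. -/
theorem measureReal_forall_lt_notMem [IsProbabilityMeasure μ] (hX : ∀ n, Measurable (X n))
    (hT : IsIndependentMarking μ X T q) (hq : ∀ i, Measurable (q i)) (hq0 : ∀ i x, 0 ≤ q i x)
    (hq1 : ∀ x, ∑ i, q i x = 1) {D : LinkState → Set Plane}
    (hD : ∀ i, MeasurableSet (D i)) (M : ℕ) :
    μ.real {ω | ∀ n < M, X n ω ∉ D (T n ω)} =
      ∫ ω, ∏ n ∈ Finset.range M, (1 - ∑ i, (D i).indicator (q i) (X n ω)) ∂μ := by
  classical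
  have hq_le : ∀ i x, q i x ≤ 1 := fun i x =>
    (hq1 x).subst (Finset.single_le_sum (f := fun i => q i x) (fun j _ => hq0 j x)
      (Finset.mem_univ i))
  have hunion : {ω | ∀ n < M, X n ω ∉ D (T n ω)} =
      ⋃ p : Fin M → LinkState, {ω | ∀ n : Fin M, T n ω = p n ∧ X n ω ∉ D (p n)} := by
    ext ω
    simp only [mem_ofPred_eq, mem_iUnion]
    constructor
    · exact fun h => ⟨fun n => T n ω, fun n => ⟨rfl, h n n.2⟩⟩
    · rintro ⟨p, hp⟩ n hn
      rw [(hp ⟨n, hn⟩).1]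
      exact (hp ⟨n, hn⟩).2
  have hmeas : ∀ p : Fin M → LinkState,
      MeasurableSet {ω | ∀ n : Fin M, T n ω = p n ∧ X n ω ∉ D (p n)} := by
    intro p
    have : {ω | ∀ n : Fin M, T n ω = p n ∧ X n ω ∉ D (p n)} =
        ⋂ n : Fin M, T n ⁻¹' {p n} ∩ X n ⁻¹' (D (p n))ᶜ := by ext; simp
    rw [this]
    exact .iInter fun n =>
      (hT.measurable n (measurableSet_singleton _)).inter (hX n (hD (p n)).compl)
  rw [hunion, measureReal_iUnion_fintype ?_ hmeas]
  · simp_rw [measureReal_marks_inter hX hT hD M]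
    rw [← integral_finsetSum]
    · refine integral_congr_ae (ae_of_all _ fun ω => ?_)
      dsimp only
      rw [Finset.prod_range, ← Fintype.piFinset_univ, ← Finset.prod_univ_sum (fun _ => Finset.univ)
        (fun (n : Fin M) i => if X n ω ∈ D i then 0 else q i (X n ω))]
      refine Finset.prod_congr rfl fun n _ => ?_
      rw [← hq1 (X n ω), ← Finset.sum_sub_distrib]
      refine Finset.sum_congr rfl fun i _ => ?_
      by_cases hx : X n ω ∈ D i <;> simp [hx]
    · intro p _
      refine Integrable.of_bound (Measurable.aestronglyMeasurable ?_) 1 (ae_of_all _ fun ω => ?_)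
      · exact Finset.measurable_fun_prod _ fun n _ => Measurable.ite (hX n (hD (p n)))
          measurable_const ((hq _).comp (hX n))
      · have h0 : ∀ n : Fin M, 0 ≤ (if X n ω ∈ D (p n) then 0 else q (p n) (X n ω)) := fun n => by
          split_ifs; exacts [le_rfl, hq0 _ _]
        rw [Real.norm_of_nonneg (Finset.prod_nonneg fun n _ => h0 n)]
        refine Finset.prod_le_one (fun n _ => h0 n) fun n _ => ?_
        split_ifs; exacts [zero_le_one, hq_le _ _]
  · intro p p' hpp'
    refine Set.disjoint_left.2 fun ω h h' => hpp' (funext fun n => ?_)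
    exact (h n).1.symm.trans (h' n).1

/-- Void probabilities of an independently marked Poisson process. -/
theorem measureReal_forall_notMem [IsProbabilityMeasure μ] (hX : IsHomogeneousPoisson μ X lam)
    (hlam : 0 < lam) (hT : IsIndependentMarking μ X T q) (hq : ∀ i, Measurable (q i))
    (hq0 : ∀ i x, 0 ≤ q i x) (hq1 : ∀ x, ∑ i, q i x = 1) {D : LinkState → Set Plane}
    (hD : ∀ i, MeasurableSet (D i)) (hv : ∀ i, volume (D i) < ⊤) :
    μ.real {ω | ∀ n, X n ω ∉ D (T n ω)} =
      Real.exp (-(lam * ∑ i, ∫ x in D i, q i x)) := by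
  have hq_le : ∀ i x, q i x ≤ 1 := fun i x =>
    (hq1 x).subst (Finset.single_le_sum (f := fun i => q i x) (fun j _ => hq0 j x)
      (Finset.mem_univ i))
  have hint : ∀ i, Integrable ((D i).indicator (q i)) := fun i => by
    rw [integrable_indicator_iff (hD i)]
    exact Measure.integrableOn_of_bounded (M := 1) (hv i).ne (hq i).aestronglyMeasurable
      (ae_of_all _ fun x => by rw [Real.norm_of_nonneg (hq0 i x)]; exact hq_le i x)
  have hpgfl := tendsto_integral_prod_one_sub hX hlam
    (u := fun x => ∑ i, (D i).indicator (q i) x)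
    (Finset.measurable_fun_sum _ fun i _ => (hq i).indicator (hD i))
    (fun x => Finset.sum_nonneg fun i _ => indicator_nonneg (fun y _ => hq0 i y) x)
    (fun x => (Finset.sum_le_sum fun i _ => indicator_le_self' (fun y _ => hq0 i y) x).trans
      (hq1 x).le)
    (B := ⋃ i, D i) (.iUnion hD) ((measure_iUnion_fintype_le _ _).trans_lt
      (ENNReal.sum_lt_top.2 fun i _ => hv i))
    (fun x hx => Finset.sum_eq_zero fun i _ =>
      indicator_of_notMem (fun h => hx (mem_iUnion_of_mem i h)) _)
  rw [integral_finsetSum _ fun i _ => hint i] at hpgfl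
  simp_rw [integral_indicator (hD _), ← measureReal_forall_lt_notMem hX.measurable hT hq hq0 hq1 hD]
    at hpgfl
  -- The events for the first M points decrease to the event for all points, so continuity from
  -- above gives the second limit.
  refine tendsto_nhds_unique ?_ hpgfl
  have hset : {ω | ∀ n, X n ω ∉ D (T n ω)} = ⋂ M, {ω | ∀ n < M, X n ω ∉ D (T n ω)} := by
    ext ω
    simp only [mem_ofPred_eq, mem_iInter]
    exact ⟨fun h M n _ => h n, fun h n => h (n + 1) n n.lt_succ_self⟩
  rw [hset]
  refine (ENNReal.tendsto_toReal (measure_ne_top _ _)).comp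
    (tendsto_measure_iInter_atTop (fun M => ?_) (fun M N hMN ω h n hn => h n (hn.trans_le hMN))
      ⟨0, measure_ne_top _ _⟩)
  have : {ω | ∀ n < M, X n ω ∉ D (T n ω)} = ⋂ n ∈ Finset.range M, {ω | X n ω ∉ D (T n ω)} := by
    ext ω; simp
  rw [this]
  exact (Finset.measurableSet_biInter _ fun n _ =>
    measurableSet_notMem hX.measurable hT.measurable hD n).nullMeasurableSet

end Marking

/-! ### The state probabilities, the void function and its derivative -/

section Analysis

variable {h C Y lam : ℝ}

lemma continuous_slant (h : ℝ) : Continuous (slant h) := by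
  unfold slant; fun_prop

lemma continuous_div_slant (h : ℝ) : Continuous fun ρ => h / slant h ρ := by
  rcases eq_or_ne h 0 with rfl | hne
  · simpa using continuous_const
  · refine continuous_const.div (continuous_slant h) fun ρ => ?_
    have : 0 < ρ ^ 2 + h ^ 2 := by positivity
    exact (Real.sqrt_pos.2 this).ne'

lemma one_add_mul_exp_pos (hC : 0 < C) (x : ℝ) : 0 < 1 + C * Real.exp x := by positivity

lemma continuous_stateProb (hC : 0 < C) (i : LinkState) : Continuous (stateProb h C Y i) := by
  have hlos : Continuous fun ρ => losProb h C Y (slant h ρ) := by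
    unfold losProb
    refine continuous_const.div ?_ fun ρ => (one_add_mul_exp_pos hC _).ne'
    have := Real.continuous_arcsin.comp (continuous_div_slant h)
    simp only [Function.comp_def] at this
    fun_prop
  cases i
  · exact hlos
  · exact continuous_const.sub hlos

lemma stateProb_add_opp (i : LinkState) (ρ : ℝ) :
    stateProb h C Y i ρ + stateProb h C Y i.opp ρ = 1 := by
  cases i <;> simp [stateProb, LinkState.opp]

/-- The arcsine is bounded, so the exponent stays in [-E, E]. This uniform bound makes ∫ p_i(ρ) ρ dρ
diverge, and hence forces a UAV in each state to exist almost surely. -/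
lemma exists_le_stateProb (h Y : ℝ) (hC : 0 < C) :
    ∃ δ > 0, ∀ i ρ, δ ≤ stateProb h C Y i ρ := by
  set E := |Y| * (Real.pi / 2 * (180 / Real.pi) + C) with hE
  have hpi := Real.pi_pos
  have hbound : ∀ ρ, |-(Y * (Real.arcsin (h / slant h ρ) * (180 / Real.pi) - C))| ≤ E := by
    intro ρ
    rw [abs_neg, abs_mul]
    refine mul_le_mul_of_nonneg_left ?_ (abs_nonneg Y)
    refine (abs_sub _ _).trans ?_
    rw [abs_mul, abs_of_pos hC, abs_of_pos (a := 180 / Real.pi) (by positivity)]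
    gcongr
    exact abs_le.2 ⟨Real.neg_pi_div_two_le_arcsin _, Real.arcsin_le_pi_div_two _⟩
  have hl : 0 < 1 / (1 + C * Real.exp E) := by positivity
  have hn : 0 < 1 - 1 / (1 + C * Real.exp (-E)) := by
    rw [sub_pos, div_lt_one (by positivity)]
    have : 0 < C * Real.exp (-E) := by positivity
    linarith
  refine ⟨min _ _, lt_min hl hn, fun i ρ => ?_⟩
  obtain ⟨h1, h2⟩ := abs_le.1 (hbound ρ)
  cases i
  · refine (min_le_left _ _).trans ?_
    simp only [stateProb, losProb]
    gcongr
  · refine (min_le_right _ _).trans ?_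
    simp only [stateProb, losProb]
    gcongr

lemma stateProb_pos (hC : 0 < C) (i : LinkState) (ρ : ℝ) : 0 < stateProb h C Y i ρ := by
  obtain ⟨δ, hδ, hle⟩ := exists_le_stateProb h Y hC
  exact hδ.trans_le (hle i ρ)

lemma sum_stateProb (ρ : ℝ) : ∑ i, stateProb h C Y i ρ = 1 := by
  rw [sum_linkState _ .los, stateProb_add_opp]

lemma continuous_stateProb_mul (hC : 0 < C) (i : LinkState) :
    Continuous fun ρ => stateProb h C Y i ρ * ρ :=
  (continuous_stateProb hC i).mul continuous_id

lemma hasDerivAt_voidProb (hC : 0 < C) (lam : ℝ) (i : LinkState) (s : ℝ) :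
    HasDerivAt (voidProb h C Y lam i)
      (-(2 * Real.pi * lam * s * stateProb h C Y i s * voidProb h C Y lam i s)) s := by
  have hc := continuous_stateProb_mul (h := h) (Y := Y) hC i
  have h1 := intervalIntegral.integral_hasDerivAt_right (hc.intervalIntegrable 0 s)
    (hc.stronglyMeasurableAtFilter _ _) hc.continuousAt
  have h2 := (h1.const_mul (2 * Real.pi * lam)).neg.exp
  refine h2.congr_deriv ?_
  simp only [voidProb, Pi.neg_apply]
  ring

lemma continuous_voidProb (hC : 0 < C) (lam : ℝ) (i : LinkState) :
    Continuous (voidProb h C Y lam i) :=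
  continuous_iff_continuousAt.2 fun s => (hasDerivAt_voidProb hC lam i s).continuousAt

lemma voidProb_pos (h C Y lam : ℝ) (i : LinkState) (s : ℝ) : 0 < voidProb h C Y lam i s :=
  Real.exp_pos _

lemma voidProb_zero (h C Y lam : ℝ) (i : LinkState) : voidProb h C Y lam i 0 = 1 := by
  simp [voidProb]

lemma voidProb_le_one (hC : 0 < C) (hlam : 0 < lam) (i : LinkState) {s : ℝ} (hs : 0 ≤ s) :
    voidProb h C Y lam i s ≤ 1 := by
  rw [voidProb, Real.exp_le_one_iff, neg_nonpos]
  have hpi := Real.pi_pos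
  refine mul_nonneg (by positivity) (intervalIntegral.integral_nonneg hs fun ρ hρ => ?_)
  exact mul_nonneg (stateProb_pos hC i ρ).le hρ.1

lemma tendsto_voidProb (hC : 0 < C) (hlam : 0 < lam) (i : LinkState) :
    Tendsto (voidProb h C Y lam i) atTop (𝓝 0) := by
  obtain ⟨δ, hδ, hle⟩ := exists_le_stateProb h Y hC
  have hpi := Real.pi_pos
  have hlow : ∀ s : ℝ, 0 ≤ s → δ * (s ^ 2 / 2) ≤ ∫ ρ in (0 : ℝ)..s, stateProb h C Y i ρ * ρ := by
    intro s hs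
    have h1 : ∫ ρ in (0 : ℝ)..s, δ * ρ = δ * (s ^ 2 / 2) := by
      rw [intervalIntegral.integral_const_mul, integral_id]; ring
    rw [← h1]
    refine intervalIntegral.integral_mono_on hs (Continuous.intervalIntegrable (by fun_prop) _ _)
      ((continuous_stateProb_mul hC i).intervalIntegrable _ _) fun ρ hρ => ?_
    exact mul_le_mul_of_nonneg_right (hle i ρ) hρ.1
  refine Real.tendsto_exp_neg_atTop_nhds_zero.comp (Tendsto.const_mul_atTop (by positivity) ?_)
  refine tendsto_atTop_mono' atTop ((eventually_ge_atTop 0).mono hlow) ?_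
  exact ((tendsto_pow_atTop two_ne_zero).atTop_div_const two_pos).const_mul_atTop hδ

lemma radialDensity_nonneg (hC : 0 < C) (hlam : 0 < lam) (i : LinkState) {ρ : ℝ} (hρ : 0 ≤ ρ) :
    0 ≤ 2 * Real.pi * lam * ρ * stateProb h C Y i ρ * voidProb h C Y lam i ρ := by
  have := stateProb_pos (h := h) (Y := Y) hC i ρ
  have := voidProb_pos h C Y lam i ρ
  have := Real.pi_pos
  positivity

lemma continuous_radialDensity (hC : 0 < C) (lam : ℝ) (i : LinkState) :
    Continuous fun ρ => 2 * Real.pi * lam * ρ * stateProb h C Y i ρ * voidProb h C Y lam i ρ :=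
  ((continuous_const.mul continuous_id).mul (continuous_stateProb hC i)).mul
    (continuous_voidProb hC lam i)

lemma integrableOn_radialDensity (hC : 0 < C) (hlam : 0 < lam) (i : LinkState) {s : ℝ}
    (hs : 0 ≤ s) : IntegrableOn
      (fun ρ => 2 * Real.pi * lam * ρ * stateProb h C Y i ρ * voidProb h C Y lam i ρ) (Ioi s) := by
  have := integrableOn_Ioi_deriv_of_nonpos'
    (fun x _ => hasDerivAt_voidProb (h := h) (Y := Y) hC lam i x)
    (fun x hx => neg_nonpos.2 (radialDensity_nonneg hC hlam i (hs.trans (mem_Ioi.1 hx).le)))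
    (tendsto_voidProb hC hlam i)
  simpa using this.neg

lemma integral_radialDensity (hC : 0 < C) (hlam : 0 < lam) (i : LinkState) {s : ℝ}
    (hs : 0 ≤ s) :
    ∫ ρ in Ioi s, 2 * Real.pi * lam * ρ * stateProb h C Y i ρ * voidProb h C Y lam i ρ =
      voidProb h C Y lam i s := by
  have := integral_Ioi_of_hasDerivAt_of_nonpos'
    (fun x _ => hasDerivAt_voidProb (h := h) (Y := Y) hC lam i x)
    (fun x hx => neg_nonpos.2 (radialDensity_nonneg hC hlam i (hs.trans (mem_Ioi.1 hx).le)))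
    (tendsto_voidProb hC hlam i)
  rw [integral_neg] at this
  linarith

/-- Polar coordinates: the factor 2π is the dimension times the area of the unit disc. -/
lemma setIntegral_ball_stateProb (h C Y : ℝ) (i : LinkState) {s : ℝ} (hs : 0 ≤ s) :
    ∫ x in Metric.ball (0 : Plane) s, stateProb h C Y i ‖x‖ =
      2 * Real.pi * ∫ ρ in (0 : ℝ)..s, stateProb h C Y i ρ * ρ := by
  have h1 : ∀ x : Plane, (Metric.ball (0 : Plane) s).indicator (fun x => stateProb h C Y i ‖x‖) x =
      (Iio s).indicator (stateProb h C Y i) ‖x‖ := fun x => by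
    by_cases hx : ‖x‖ < s <;> simp [hx]
  rw [← integral_indicator measurableSet_ball]
  simp_rw [h1]
  rw [integral_fun_norm_addHaar volume ((Iio s).indicator (stateProb h C Y i))]
  have h2 : volume.real (Metric.ball (0 : Plane) 1) = Real.pi := by
    simp [Measure.real, EuclideanSpace.volume_ball_fin_two, Real.pi_pos.le]
  have h3 : ∀ y : ℝ, y ^ (Module.finrank ℝ Plane - 1) • (Iio s).indicator (stateProb h C Y i) y =
      (Iio s).indicator (fun ρ => stateProb h C Y i ρ * ρ) y := fun y => by
    by_cases hy : y < s <;> simp [hy, mul_comm]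
  simp_rw [h3]
  rw [h2, setIntegral_indicator measurableSet_Iio, Ioi_inter_Iio,
    ← integral_Ioc_eq_integral_Ioo, ← intervalIntegral.integral_of_le hs]
  simp
  ring

end Analysis

/-- Horizontal distance from the UE to the closest UAV with link state `i` (`⊤` if there is
none). -/
noncomputable def nearestEDist {Ω : Type*} (X : ℕ → Ω → Plane) (T : ℕ → Ω → LinkState)
    (i : LinkState) (ω : Ω) : ℝ≥0∞ :=
  ⨅ n, if T n ω = i then ‖X n ω‖ₑ else ⊤

/-- Real-valued version of `nearestEDist`. -/
noncomputable def nearestDist {Ω : Type*} (X : ℕ → Ω → Plane) (T : ℕ → Ω → LinkState)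
    (i : LinkState) (ω : Ω) : ℝ :=
  (nearestEDist X T i ω).toReal

/-- Finiteness is essential, because `toReal` sends `⊤` to 0. -/
lemma le_nearestDist_iff {Ω : Type*} {X : ℕ → Ω → Plane} {T : ℕ → Ω → LinkState} {i : LinkState}
    {ω : Ω} (hfin : nearestEDist X T i ω ≠ ⊤) {s : ℝ} :
    s ≤ nearestDist X T i ω ↔ ∀ n, T n ω = i → s ≤ ‖X n ω‖ := by
  rw [nearestDist, ← ENNReal.ofReal_le_iff_le_toReal hfin, nearestEDist, le_iInf_iff]
  refine forall_congr' fun n => ?_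
  split_ifs with hn
  · simp [hn, ← ofReal_norm, ENNReal.ofReal_le_ofReal_iff]
  · simp [hn]

/-! ### Joint law of the two nearest distances -/

section Nearest

variable {Ω : Type*} [MeasurableSpace Ω] {μ : Measure Ω} {X : ℕ → Ω → Plane}
  {T : ℕ → Ω → LinkState} {h C Y lam : ℝ}

lemma measurable_nearestEDist (hX : ∀ n, Measurable (X n)) (hT : ∀ n, Measurable (T n))
    (i : LinkState) : Measurable (nearestEDist X T i) :=
  Measurable.iInf fun n => Measurable.ite (hT n (measurableSet_singleton i))
    (hX n).enorm measurable_const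

lemma measurable_nearestDist (hX : ∀ n, Measurable (X n)) (hT : ∀ n, Measurable (T n))
    (i : LinkState) : Measurable (nearestDist X T i) :=
  (measurable_nearestEDist hX hT i).ennreal_toReal

/-- The forbidden sets are open discs, one radius per state; the sum over states in the exponent
becomes a product, the source of the independence below. -/
lemma measureReal_le_norm [IsProbabilityMeasure μ] (hC : 0 < C) (hlam : 0 < lam)
    (hX : IsHomogeneousPoisson μ X lam)
    (hT : IsIndependentMarking μ X T (fun i x => stateProb h C Y i ‖x‖)) (s : LinkState → ℝ)
    (hs : ∀ i, 0 ≤ s i) :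
    μ.real {ω | ∀ i n, T n ω = i → s i ≤ ‖X n ω‖} = ∏ i, voidProb h C Y lam i (s i) := by
  have hset : {ω | ∀ i n, T n ω = i → s i ≤ ‖X n ω‖} =
      {ω | ∀ n, X n ω ∉ (fun i => Metric.ball (0 : Plane) (s i)) (T n ω)} := by
    ext ω
    simp only [mem_ofPred_eq, mem_ball_zero_iff, not_lt]
    exact ⟨fun H n => H _ n rfl, fun H i n hn => hn ▸ H n⟩
  rw [hset, measureReal_forall_notMem hX hlam hT
    (fun i => (continuous_stateProb hC i).measurable.comp measurable_norm)
    (fun i x => (stateProb_pos hC i _).le) (fun x => sum_stateProb _)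
    (fun i => measurableSet_ball) (fun i => measure_ball_lt_top), Finset.mul_sum,
    ← Finset.sum_neg_distrib, Real.exp_sum]
  refine Finset.prod_congr rfl fun i _ => ?_
  rw [setIntegral_ball_stateProb h C Y i (hs i), voidProb]
  congr 1
  ring

lemma measureReal_forall_le_norm [IsProbabilityMeasure μ] (hC : 0 < C) (hlam : 0 < lam)
    (hX : IsHomogeneousPoisson μ X lam)
    (hT : IsIndependentMarking μ X T (fun i x => stateProb h C Y i ‖x‖)) (i : LinkState) {s : ℝ}
    (hs : 0 ≤ s) :
    μ.real {ω | ∀ n, T n ω = i → s ≤ ‖X n ω‖} = voidProb h C Y lam i s := by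
  -- Radius 0 imposes nothing on the other state.
  have := measureReal_le_norm hC hlam hX hT (fun j => if j = i then s else 0)
    (fun j => by split_ifs; exacts [hs, le_rfl])
  rw [Finset.prod_eq_single i (fun j _ hj => by rw [if_neg hj, voidProb_zero]) (by simp),
    if_pos rfl] at this
  rw [← this]
  congr 1
  ext ω
  simp only [mem_ofPred_eq]
  constructor
  · intro H j n hn
    split_ifs with hj
    · exact H n (hn.trans hj)
    · exact norm_nonneg _
  · intro H n hn
    simpa using H i n hn

/-- Without UAVs in state i every disc is free of them, and the probability of that tends to 0 with
growing radius. -/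
lemma ae_nearestEDist_ne_top [IsProbabilityMeasure μ] (hC : 0 < C) (hlam : 0 < lam)
    (hX : IsHomogeneousPoisson μ X lam)
    (hT : IsIndependentMarking μ X T (fun i x => stateProb h C Y i ‖x‖)) (i : LinkState) :
    ∀ᵐ ω ∂μ, nearestEDist X T i ω ≠ ⊤ := by
  have hle : μ.real {ω | nearestEDist X T i ω = ⊤} ≤ 0 := by
    refine ge_of_tendsto (tendsto_voidProb (h := h) (Y := Y) hC hlam i) ?_
    filter_upwards [eventually_ge_atTop 0] with s hs
    rw [← measureReal_forall_le_norm hC hlam hX hT i hs]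
    refine measureReal_mono fun ω hω n hn => ?_
    simp only [mem_ofPred_eq, nearestEDist, iInf_eq_top] at hω
    simpa [hn] using hω n
  have h0 := le_antisymm hle measureReal_nonneg
  rw [measureReal_eq_zero_iff] at h0
  exact (ae_iff.2 (by simpa using h0))

/-- For s < 0 the event is certain while `voidProb` at s is below 1, hence the maximum. -/
lemma measureReal_le_nearestDist [IsProbabilityMeasure μ] (hC : 0 < C) (hlam : 0 < lam)
    (hX : IsHomogeneousPoisson μ X lam)
    (hT : IsIndependentMarking μ X T (fun i x => stateProb h C Y i ‖x‖)) (i : LinkState) (s : ℝ) :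
    μ.real (nearestDist X T i ⁻¹' Ici s) = voidProb h C Y lam i (max s 0) := by
  rw [← measureReal_forall_le_norm hC hlam hX hT i (le_max_right s 0)]
  refine measureReal_congr ?_
  filter_upwards [ae_nearestEDist_ne_top hC hlam hX hT i] with ω hω
  refine propext ?_
  change s ≤ nearestDist X T i ω ↔ ∀ n, T n ω = i → max s 0 ≤ ‖X n ω‖
  rw [le_nearestDist_iff hω]
  simp

lemma measureReal_le_nearestDist_inter [IsProbabilityMeasure μ] (hC : 0 < C) (hlam : 0 < lam)
    (hX : IsHomogeneousPoisson μ X lam)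
    (hT : IsIndependentMarking μ X T (fun i x => stateProb h C Y i ‖x‖)) (i : LinkState)
    (s t : ℝ) :
    μ.real (nearestDist X T i ⁻¹' Ici s ∩ nearestDist X T i.opp ⁻¹' Ici t) =
      voidProb h C Y lam i (max s 0) * voidProb h C Y lam i.opp (max t 0) := by
  have := measureReal_le_norm hC hlam hX hT (fun j => if j = i then max s 0 else max t 0)
    (fun j => by split_ifs <;> exact le_max_right _ _)
  have hprod : ∀ f : LinkState → ℝ, ∏ j, f j = f i * f i.opp := by
    intro f
    rw [← Finset.prod_pair i.opp_ne.symm]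
    congr 1
    ext j
    by_cases hj : j = i
    · simp [hj]
    · simp [LinkState.eq_opp_of_ne hj]
  rw [hprod, if_pos rfl, if_neg i.opp_ne] at this
  rw [← this]
  refine measureReal_congr ?_
  filter_upwards [ae_nearestEDist_ne_top hC hlam hX hT i,
    ae_nearestEDist_ne_top hC hlam hX hT i.opp] with ω hω hω'
  refine propext ?_
  change s ≤ nearestDist X T i ω ∧ t ≤ nearestDist X T i.opp ω ↔
    ∀ j n, T n ω = j → (if j = i then max s 0 else max t 0) ≤ ‖X n ω‖
  rw [le_nearestDist_iff hω, le_nearestDist_iff hω']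
  constructor
  · rintro ⟨h1, h2⟩ j n hn
    split_ifs with hj
    · exact max_le (h1 n (hn.trans hj)) (norm_nonneg _)
    · exact max_le (h2 n (hn.trans (LinkState.eq_opp_of_ne hj))) (norm_nonneg _)
  · intro H
    refine ⟨fun n hn => ?_, fun n hn => ?_⟩
    · have := H i n hn
      rw [if_pos rfl] at this
      exact (le_max_left _ _).trans this
    · have := H i.opp n hn
      rw [if_neg i.opp_ne] at this
      exact (le_max_left _ _).trans this

lemma indepFun_of_Ici {f g : Ω → ℝ} [IsProbabilityMeasure μ] (hf : Measurable f)
    (hg : Measurable g)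
    (H : ∀ s t, μ.real (f ⁻¹' Ici s ∩ g ⁻¹' Ici t) = μ.real (f ⁻¹' Ici s) * μ.real (g ⁻¹' Ici t)) :
    IndepFun f g μ := by
  have hgen : (inferInstance : MeasurableSpace ℝ) = MeasurableSpace.generateFrom (range Ici) := by
    rw [← borel_eq_generateFrom_Ici]; exact BorelSpace.measurable_eq
  have hgen' : ∀ k : Ω → ℝ, MeasurableSpace.comap k inferInstance =
      MeasurableSpace.generateFrom (preimage k '' range Ici) := fun k => by
    rw [hgen, MeasurableSpace.comap_generateFrom]
  have hpi : IsPiSystem (range (Ici : ℝ → Set ℝ)) := by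
    rintro _ ⟨a, rfl⟩ _ ⟨b, rfl⟩ _
    exact ⟨a ⊔ b, Ici_inter_Ici.symm⟩
  have hpi' : ∀ k : Ω → ℝ, IsPiSystem (preimage k '' range Ici) := by
    rintro k _ ⟨A, hA, rfl⟩ _ ⟨B, hB, rfl⟩ hne
    refine ⟨A ∩ B, hpi A hA B hB ?_, rfl⟩
    exact hne.elim fun ω hω => ⟨k ω, hω⟩
  rw [IndepFun_iff_Indep]
  refine IndepSets.indep hf.comap_le hg.comap_le (hpi' f) (hpi' g) (hgen' f) (hgen' g) ?_
  rw [IndepSets_iff]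
  rintro _ _ ⟨_, ⟨s, rfl⟩, rfl⟩ ⟨_, ⟨t, rfl⟩, rfl⟩
  rw [← ENNReal.toReal_eq_toReal_iff' (measure_ne_top _ _)
    (ENNReal.mul_ne_top (measure_ne_top _ _) (measure_ne_top _ _)), ENNReal.toReal_mul]
  exact H s t

lemma indepFun_nearestDist [IsProbabilityMeasure μ] (hC : 0 < C) (hlam : 0 < lam)
    (hX : IsHomogeneousPoisson μ X lam)
    (hT : IsIndependentMarking μ X T (fun i x => stateProb h C Y i ‖x‖)) (i : LinkState) :
    IndepFun (nearestDist X T i) (nearestDist X T i.opp) μ := by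
  refine indepFun_of_Ici (measurable_nearestDist hX.measurable hT.measurable i)
    (measurable_nearestDist hX.measurable hT.measurable i.opp) fun s t => ?_
  rw [measureReal_le_nearestDist_inter hC hlam hX hT, measureReal_le_nearestDist hC hlam hX hT,
    measureReal_le_nearestDist hC hlam hX hT]

/-- Law of the horizontal distance to the closest UAV in a given link state. -/
lemma map_nearestDist [IsProbabilityMeasure μ] (hC : 0 < C) (hlam : 0 < lam)
    (hX : IsHomogeneousPoisson μ X lam)
    (hT : IsIndependentMarking μ X T (fun i x => stateProb h C Y i ‖x‖)) (i : LinkState) :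
    μ.map (nearestDist X T i) = (volume.restrict (Ioi 0)).withDensity fun ρ => ENNReal.ofReal
      (2 * Real.pi * lam * ρ * stateProb h C Y i ρ * voidProb h C Y lam i ρ) := by
  have hR := measurable_nearestDist hX.measurable hT.measurable i
  have : IsProbabilityMeasure (μ.map (nearestDist X T i)) :=
    Measure.isProbabilityMeasure_map hR.aemeasurable
  refine Measure.ext_of_Ici _ _ fun s => ?_
  rw [Measure.map_apply hR measurableSet_Ici, withDensity_apply _ measurableSet_Ici,
    Measure.restrict_restrict measurableSet_Ici]
  have hae : (Ici s ∩ Ioi 0 : Set ℝ) =ᵐ[volume] Ioi (max s 0) := by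
    rw [← Ioi_inter_Ioi]
    exact (Ioi_ae_eq_Ici.symm).inter (ae_eq_refl _)
  rw [Measure.restrict_congr_set hae, ← ofReal_integral_eq_lintegral_ofReal
    (integrableOn_radialDensity hC hlam i (le_max_right s 0)), integral_radialDensity hC hlam i
    (le_max_right s 0), ← measureReal_le_nearestDist hC hlam hX hT i s, ofReal_measureReal]
  refine (ae_restrict_mem measurableSet_Ioi).mono fun ρ hρ => ?_
  exact radialDensity_nonneg hC hlam i ((le_max_right s 0).trans (mem_Ioi.1 hρ).le)

end Nearest

/-! ### The connection event in terms of nearest distances -/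

section Geometry

variable {h : ℝ} {G a : LinkState → ℝ}

lemma slant_pos {ρ : ℝ} (h : ℝ) (hρ : 0 < ρ) : 0 < slant h ρ :=
  Real.sqrt_pos.2 (by positivity)

lemma slant_le_slant (h : ℝ) {ρ ρ' : ℝ} (hρ : 0 ≤ ρ) (hle : ρ ≤ ρ') : slant h ρ ≤ slant h ρ' :=
  Real.sqrt_le_sqrt (by gcongr)

lemma horiz_slant (h : ℝ) {ρ : ℝ} (hρ : 0 ≤ ρ) : horiz h (slant h ρ) = ρ := by
  rw [horiz, slant, Real.sq_sqrt (by positivity), add_sub_cancel_right, Real.sqrt_sq hρ]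

lemma slant_horiz {r : ℝ} (hh : 0 ≤ h) (hr : h ≤ r) : slant h (horiz h r) = r := by
  rw [horiz, slant, Real.sq_sqrt (sub_nonneg.2 (pow_le_pow_left₀ hh hr 2)), sub_add_cancel,
    Real.sqrt_sq (hh.trans hr)]

lemma horiz_le_iff {r ρ : ℝ} (hr : 0 ≤ r) (hρ : 0 ≤ ρ) : horiz h r ≤ ρ ↔ r ≤ slant h ρ := by
  rw [horiz, slant, Real.sqrt_le_left hρ, Real.le_sqrt hr, sub_le_iff_le_add]
  positivity

lemma exclusionDist_nonneg (hG : ∀ i, 0 < G i) (i : LinkState) {r : ℝ} (hr : 0 ≤ r) :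
    0 ≤ exclusionDist G a i r :=
  Real.rpow_nonneg (mul_nonneg (div_pos (hG _) (hG _)).le (Real.rpow_nonneg hr _)) _

lemma pathGain_le_pathGain (hG : ∀ i, 0 < G i) (ha : ∀ i, 0 < a i) (i : LinkState) {r r' : ℝ}
    (hr : 0 < r) (hle : r ≤ r') : pathGain G a i r' ≤ pathGain G a i r :=
  mul_le_mul_of_nonneg_left
    (Real.rpow_le_rpow_of_nonpos hr hle (neg_nonpos.2 (ha i).le)) (hG i).le

/-- A_i(r) is the distance at which the opposite state has the gain that state i has at r. -/
lemma pathGain_opp_le_iff (hG : ∀ i, 0 < G i) (ha : ∀ i, 0 < a i) (i : LinkState) {r r' : ℝ}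
    (hr : 0 < r) (hr' : 0 < r') :
    pathGain G a i.opp r' ≤ pathGain G a i r ↔ exclusionDist G a i r ≤ r' := by
  have h1 : 0 < r ^ a i := Real.rpow_pos_of_pos hr _
  have h2 : 0 < r' ^ a i.opp := Real.rpow_pos_of_pos hr' _
  rw [exclusionDist, one_div, Real.rpow_inv_le_iff_of_pos
    (mul_pos (div_pos (hG _) (hG _)) h1).le hr'.le (ha _), pathGain, pathGain,
    Real.rpow_neg hr.le, Real.rpow_neg hr'.le, ← div_eq_mul_inv, ← div_eq_mul_inv,
    div_le_div_iff₀ h2 h1, div_mul_eq_mul_div, div_le_iff₀ (hG i), mul_comm (r' ^ _)]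

lemma hasDerivAt_slant (h : ℝ) {ρ : ℝ} (hρ : 0 < ρ) :
    HasDerivAt (slant h) (ρ / slant h ρ) ρ := by
  have h1 : HasDerivAt (fun ρ : ℝ => ρ ^ 2 + h ^ 2) (2 * ρ) ρ := by
    simpa using ((hasDerivAt_pow 2 ρ).add_const (h ^ 2))
  refine (h1.sqrt (by positivity)).congr_deriv ?_
  rw [slant, mul_div_mul_left _ _ two_ne_zero]

lemma injOn_slant (h : ℝ) : InjOn (slant h) (Ioi 0) := fun x hx y hy hxy => by
  rw [← horiz_slant h (mem_Ioi.1 hx).le, hxy, horiz_slant h (mem_Ioi.1 hy).le]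

lemma slant_image_Ioi (hh : 0 ≤ h) : slant h '' Ioi 0 = Ioi h := by
  ext r
  constructor
  · rintro ⟨ρ, hρ, rfl⟩
    have hρ : 0 < ρ := hρ
    exact Real.lt_sqrt_of_sq_lt (by nlinarith [sq_pos_of_pos hρ])
  · intro hr
    have hr : h < r := hr
    exact ⟨horiz h r, Real.sqrt_pos.2 (sub_pos.2 (pow_lt_pow_left₀ hr hh two_ne_zero)),
      slant_horiz hh hr.le⟩

/-- Local finiteness makes the nearest distance in state i attained. Points at the origin are
excluded because for h = 0 their distance is 0, and 0 to a negative power is 0 in Lean, not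
infinite. -/
lemma mem_connects_iff {Ω : Type*} {X : ℕ → Ω → Plane} {T : ℕ → Ω → LinkState}
    (hG : ∀ i, 0 < G i) (ha : ∀ i, 0 < a i) (i : LinkState) {ω : Ω}
    (hfin : ∀ s : ℝ, {n | ‖X n ω‖ ≤ s}.Finite) (hne : ∀ n, X n ω ≠ 0)
    (hi : nearestEDist X T i ω ≠ ⊤) (ho : nearestEDist X T i.opp ω ≠ ⊤) :
    ω ∈ connects h G a X T i ↔
      horiz h (exclusionDist G a i (slant h (nearestDist X T i ω))) ≤
        nearestDist X T i.opp ω := by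
  have hpos : ∀ n, 0 < slant h ‖X n ω‖ := fun n => slant_pos h (norm_pos_iff.2 (hne n))
  obtain ⟨n₁, hn₁⟩ : ∃ n, T n ω = i := by
    by_contra! H
    exact hi (by simp [nearestEDist, H])
  obtain ⟨n₀, ⟨hT₀, hle₀⟩, hmin'⟩ := Set.exists_min_image {n | T n ω = i ∧ ‖X n ω‖ ≤ ‖X n₁ ω‖}
    (fun n => ‖X n ω‖) ((hfin _).subset fun n hn => hn.2) ⟨n₁, hn₁, le_rfl⟩
  have hmin : ∀ n, T n ω = i → ‖X n₀ ω‖ ≤ ‖X n ω‖ := fun n hn => by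
    rcases le_total ‖X n ω‖ ‖X n₁ ω‖ with h1 | h1
    · exact hmin' n ⟨hn, h1⟩
    · exact le_trans hle₀ h1
  have hR : nearestDist X T i ω = ‖X n₀ ω‖ :=
    le_antisymm ((le_nearestDist_iff hi).1 le_rfl n₀ hT₀) ((le_nearestDist_iff hi).2 hmin)
  have hgain : ∀ m, T m ω = i →
      pathGain G a i (slant h ‖X m ω‖) ≤ pathGain G a i (slant h ‖X n₀ ω‖) := fun m hm =>
    pathGain_le_pathGain hG ha i (hpos n₀) (slant_le_slant h (norm_nonneg _) (hmin m hm))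
  have hopp : ∀ m, horiz h (exclusionDist G a i (slant h ‖X n₀ ω‖)) ≤ ‖X m ω‖ ↔
      pathGain G a i.opp (slant h ‖X m ω‖) ≤ pathGain G a i (slant h ‖X n₀ ω‖) := fun m => by
    rw [horiz_le_iff (exclusionDist_nonneg hG i (hpos n₀).le) (norm_nonneg _),
      pathGain_opp_le_iff hG ha i (hpos n₀) (hpos m)]
  rw [hR, le_nearestDist_iff ho]
  constructor
  · rintro ⟨n, hn, hserv⟩ m hm
    have h1 := hserv m
    simp only [hn, hm] at h1
    exact (hopp m).2 (h1.trans (hgain n hn))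
  · intro H
    refine ⟨n₀, hT₀, fun m => ?_⟩
    simp only [hT₀]
    by_cases hm : T m ω = i
    · rw [hm]; exact hgain m hm
    · have hm' := LinkState.eq_opp_of_ne hm
      rw [hm']; exact (hopp m).1 (H m hm')

end Geometry

/-! ### The connection probability -/

section Connection

variable {Ω : Type*} [MeasurableSpace Ω] {μ : Measure Ω} {X : ℕ → Ω → Plane}
  {T : ℕ → Ω → LinkState} {h C Y lam : ℝ} {G a : LinkState → ℝ}

lemma ae_finite_ball [IsProbabilityMeasure μ] (hX : IsHomogeneousPoisson μ X lam)
    (hlam : 0 < lam) : ∀ᵐ ω ∂μ, ∀ s : ℝ, {n | ‖X n ω‖ ≤ s}.Finite := by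
  have : ∀ᵐ ω ∂μ, ∀ k : ℕ, count X (Metric.closedBall 0 k) ω ≠ ⊤ := ae_all_iff.2 fun k =>
    ae_count_ne_top hX hlam measurableSet_closedBall measure_closedBall_lt_top
  filter_upwards [this] with ω hω s
  obtain ⟨k, hk⟩ := exists_nat_ge s
  refine (Set.encard_ne_top_iff.1 (hω k)).subset fun n hn => ?_
  exact mem_closedBall_zero_iff.2 (le_trans hn hk)

lemma ae_ne_zero [IsProbabilityMeasure μ] (hX : IsHomogeneousPoisson μ X lam) :
    ∀ᵐ ω ∂μ, ∀ n, X n ω ≠ 0 := by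
  have h1 := hX.count_law {0} (measurableSet_singleton _) (by simp) 0
  have hm : MeasurableSet {ω | count X {0} ω = ((0 : ℕ) : ℕ∞)} :=
    measurable_count hX.measurable (measurableSet_singleton _) (measurableSet_singleton _)
  have h2 : μ {ω | count X {0} ω = ((0 : ℕ) : ℕ∞)} = 1 := by
    rw [← ofReal_measureReal, h1]
    simp [Measure.real]
  filter_upwards [(mem_ae_iff_prob_eq_one hm).2 h2] with ω hω n hn
  have h3 : {n | X n ω ∈ ({0} : Set Plane)}.encard = ((0 : ℕ) : ℕ∞) := hω
  rw [Nat.cast_zero, Set.encard_eq_zero] at h3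
  exact (h3 ▸ (show n ∈ {n | X n ω ∈ ({0} : Set Plane)} from hn) : n ∈ (∅ : Set ℕ))

lemma measurable_exclusionRadius (h : ℝ) (G a : LinkState → ℝ) (i : LinkState) :
    Measurable fun ρ => horiz h (exclusionDist G a i (slant h ρ)) := by
  unfold horiz exclusionDist slant
  fun_prop

lemma integrableOn_connection_radial (hC : 0 < C) (hlam : 0 < lam) (i : LinkState) :
    IntegrableOn (fun ρ => voidProb h C Y lam i.opp (horiz h (exclusionDist G a i (slant h ρ))) *
      (2 * Real.pi * lam * ρ * stateProb h C Y i ρ * voidProb h C Y lam i ρ)) (Ioi 0) := by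
  refine (integrableOn_radialDensity hC hlam i le_rfl).bdd_mul (c := 1)
    ((continuous_voidProb hC lam _).measurable.comp
      (measurable_exclusionRadius h G a i)).aestronglyMeasurable (ae_of_all _ fun ρ => ?_)
  rw [Real.norm_of_nonneg (voidProb_pos _ _ _ _ _ _).le]
  exact voidProb_le_one hC hlam _ (Real.sqrt_nonneg _)

/-- The connection probability as an integral over the horizontal distance. -/
theorem measureReal_connects_radial [IsProbabilityMeasure μ] (hC : 0 < C) (hlam : 0 < lam)
    (hG : ∀ i, 0 < G i) (ha : ∀ i, 0 < a i) (hX : IsHomogeneousPoisson μ X lam)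
    (hT : IsIndependentMarking μ X T (fun i x => stateProb h C Y i ‖x‖)) (i : LinkState) :
    μ.real (connects h G a X T i) =
      ∫ ρ in Ioi 0, voidProb h C Y lam i.opp (horiz h (exclusionDist G a i (slant h ρ))) *
        (2 * Real.pi * lam * ρ * stateProb h C Y i ρ * voidProb h C Y lam i ρ) := by
  set g : ℝ → ℝ := fun ρ => horiz h (exclusionDist G a i (slant h ρ)) with hg
  have hgm : Measurable g := measurable_exclusionRadius h G a i
  have hR := fun j => measurable_nearestDist (i := j) hX.measurable hT.measurable
  have hset : MeasurableSet {p : ℝ × ℝ | g p.1 ≤ p.2} :=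
    measurableSet_le (hgm.comp measurable_fst) measurable_snd
  have h1 : μ (connects h G a X T i) =
      μ.map (fun ω => (nearestDist X T i ω, nearestDist X T i.opp ω)) {p | g p.1 ≤ p.2} := by
    rw [Measure.map_apply ((hR i).prodMk (hR i.opp)) hset]
    refine measure_congr ?_
    filter_upwards [ae_finite_ball hX hlam, ae_ne_zero hX, ae_nearestEDist_ne_top hC hlam hX hT i,
      ae_nearestEDist_ne_top hC hlam hX hT i.opp] with ω hfin hne hi ho
    exact propext (mem_connects_iff hG ha i hfin hne hi ho)
  have h2 : ∀ ρ, μ.map (nearestDist X T i.opp) (Prod.mk ρ ⁻¹' {p | g p.1 ≤ p.2}) =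
      ENNReal.ofReal (voidProb h C Y lam i.opp (g ρ)) := fun ρ => by
    have hpre : Prod.mk ρ ⁻¹' {p : ℝ × ℝ | g p.1 ≤ p.2} = Ici (g ρ) := rfl
    rw [hpre, Measure.map_apply (hR i.opp) measurableSet_Ici, ← ofReal_measureReal,
      measureReal_le_nearestDist hC hlam hX hT, max_eq_left (show 0 ≤ g ρ from Real.sqrt_nonneg _)]
  have hV : Measurable fun ρ => voidProb h C Y lam i.opp (g ρ) :=
    (continuous_voidProb hC lam _).measurable.comp hgm
  have := Measure.isProbabilityMeasure_map (μ := μ) (hR i.opp).aemeasurable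
  -- By independence the joint law is a product; integrating out R_{i*} first leaves its tail at
  -- g(ρ).
  rw [measureReal_def, h1, (indepFun_nearestDist hC hlam hX hT i).map_prod_eq_prod_map_map
    (hR i).aemeasurable (hR i.opp).aemeasurable, Measure.prod_apply hset]
  simp_rw [h2]
  rw [map_nearestDist hC hlam hX hT i, lintegral_withDensity_eq_lintegral_mul _
    (continuous_radialDensity hC lam i).measurable.ennreal_ofReal hV.ennreal_ofReal,
    integral_eq_lintegral_of_nonneg_ae ?_
      (integrableOn_connection_radial hC hlam i).aestronglyMeasurable]
  · congr 1
    refine lintegral_congr fun ρ => ?_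
    rw [Pi.mul_apply, ENNReal.ofReal_mul (voidProb_pos _ _ _ _ _ _).le, mul_comm]
  · refine (ae_restrict_mem measurableSet_Ioi).mono fun ρ hρ => ?_
    exact mul_nonneg (voidProb_pos _ _ _ _ _ _).le
      (radialDensity_nonneg hC hlam i (mem_Ioi.1 hρ).le)

end Connection

end UAV

/-! ### Change of variables from horizontal distance to distance -/

theorem lemma2 {Ω : Type*} [MeasurableSpace Ω] (μ : Measure Ω) [IsProbabilityMeasure μ]
    (h C Y lam : ℝ) (hh : 0 ≤ h) (hC : 0 < C) (hlam : 0 < lam)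
    (G a : UAV.LinkState → ℝ) (hG : ∀ i, 0 < G i) (ha : ∀ i, 0 < a i)
    (X : ℕ → Ω → UAV.Plane) (T : ℕ → Ω → UAV.LinkState)
    (hX : UAV.IsHomogeneousPoisson μ X lam)
    (hT : UAV.IsIndependentMarking μ X T (fun i x => UAV.stateProb h C Y i ‖x‖))
    (i : UAV.LinkState) :
    IntegrableOn (fun r => UAV.voidProb h C Y lam i.opp (UAV.horiz h (UAV.exclusionDist G a i r)) *
        UAV.nearestDensity h C Y lam i r) (Ioi h) ∧
    μ.real (UAV.connects h G a X T i) =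
      ∫ r in Ioi h, UAV.voidProb h C Y lam i.opp (UAV.horiz h (UAV.exclusionDist G a i r)) *
        UAV.nearestDensity h C Y lam i r := by
  have hderiv : ∀ ρ ∈ Ioi (0 : ℝ),
      HasDerivWithinAt (UAV.slant h) (ρ / UAV.slant h ρ) (Ioi 0) ρ := fun ρ hρ =>
    (UAV.hasDerivAt_slant h hρ).hasDerivWithinAt
  -- The Jacobian ρ/r replaces the factor r of the density f_i by ρ.
  have hcongr : ∀ ρ ∈ Ioi (0 : ℝ), |ρ / UAV.slant h ρ| •
      (UAV.voidProb h C Y lam i.opp (UAV.horiz h (UAV.exclusionDist G a i (UAV.slant h ρ))) *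
        UAV.nearestDensity h C Y lam i (UAV.slant h ρ)) =
      UAV.voidProb h C Y lam i.opp (UAV.horiz h (UAV.exclusionDist G a i (UAV.slant h ρ))) *
      (2 * Real.pi * lam * ρ * UAV.stateProb h C Y i ρ * UAV.voidProb h C Y lam i ρ) := by
    intro ρ hρ
    have hρ : 0 < ρ := hρ
    have hs := UAV.slant_pos h hρ
    rw [abs_of_pos (div_pos hρ hs), UAV.nearestDensity, UAV.horiz_slant h hρ.le, smul_eq_mul]
    field_simp
  rw [← UAV.slant_image_Ioi hh, integrableOn_image_iff_integrableOn_abs_deriv_smul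
    measurableSet_Ioi hderiv (UAV.injOn_slant h), integral_image_eq_integral_abs_deriv_smul
    measurableSet_Ioi hderiv (UAV.injOn_slant h), integrableOn_congr_fun hcongr measurableSet_Ioi,
    setIntegral_congr_fun measurableSet_Ioi hcongr]
  exact ⟨UAV.integrableOn_connection_radial hC hlam i,
    UAV.measureReal_connects_radial hC hlam hG ha hX hT i⟩
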